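/- Let $Q=[-1,1]^2$ and let $\varphi_k(t)=\sqrt{k+1/2}\,(2^kk!)^{-1}\frac{d^k}{dt^k}(t^2-1)^k$, $k=0,1,2,\dots$, be the orthonormal Legendre polynomials on $[-1,1]$. For $f\in L_2(Q)$ put $\langle f,\varphi_{k,j}\rangle=\int_{-1}^1\int_{-1}^1 f(t,\tau)\varphi_k(t)\varphi_j(\tau)\,d\tau\,dt$. Let $r\ge 1$ be an integer, $1\le s<\infty$, $1\le p\le\infty$ (with $1/p=0$ for $p=\infty$) and $\mu>2r-\frac1s+\frac32$. Let $L^\mu_{s,2}$ be the class of all $f\in L_2(Q)$ with $$\|f\|_{s,\mu}^s=\sum_{k,j=0}^\infty \max\{1,kj\}^{s\mu}\,|\langle f,\varphi_{k,j}\rangle|^s\le 1 .$$ For $f\in L^\mu_{s,2}$ let $f^{(r,r)}(t,\tau)=\sum_{k,j=r}^\infty\langle f,\varphi_{k,j}\rangle\varphi_k^{(r)}(t)\varphi_j^{(r)}(\tau)$; this series converges in $C(Q)$ (uniform norm $\|\cdot\|_C$). Let $\Gamma_n=\{(k,j): kj\le rn-1,\ k,j=r,\dots,n-1\}$, and for a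 sequence $y=(y_{k,j})_{k,j\ge 0}$ of perturbed coefficients let $$\mathcal D_n^{(r,r)}y(t,\tau)=\sum_{(k,j)\in\Gamma_n}y_{k,j}\,\varphi_k^{(r)}(t)\varphi_j^{(r)}(\tau).$$ Fix $\kappa_1,\kappa_2>0$. For $0<\delta<1$ call $n\in\mathbb N$ admissible if $$\kappa_1 X_\delta\le n\le\kappa_2X_\delta,\qquad X_\delta=\Big(\delta^{-1}\ln^{\frac1p-\frac1s}\tfrac1\delta\Big)^{\frac{1}{\mu-1/p+1/s}} .$$ (i) For every $\delta_0<1$ there is a constant $C>0$, depending only on $r,s,p,\mu,\kappa_1,\kappa_2,\delta_0$, such that for all $0<\delta\le\delta_0$, all admissible $n$, all $f\in L^\mu_{s,2}$ and all $y$ with $\|(\langle f,\varphi_{k,j}\rangle-y_{k,j})_{k,j}\|_{\ell_p}\le\delta$, $$\big\|f^{(r,r)}-\mathcal D_n^{(r,r)}y\big\|_{C}\le C\Big(\delta\ln^{\frac1s-\frac1p}\tfrac1\delta\Big)^{\frac{\mu-2r+1/s-3/2}{\mu-1/p+1/s}}\ln^{2-\frac1s}\tfrac1\delta .$$ (ii)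 The method $\mathcal D_n^{(r,r)}$ uses $\operatorname{card}(\Gamma_n)$ perturbed coefficients, and for all sufficiently small $\delta$ and all admissible $n$, $$\operatorname{card}(\Gamma_n)\asymp n\ln n\asymp\Big(\delta^{-1}\ln^{\mu}\tfrac1\delta\Big)^{\frac{1}{\mu-1/p+1/s}},$$ with constants in $\asymp$ (and a bound for $\delta$) depending only on $r,s,p,\mu,\kappa_1,\kappa_2$. -/

import Mathlib

open MeasureTheory
open scoped ENNReal Nat

/-- The square `Q = [-1,1]²`. -/
abbrev Square : Type := Set.Icc (-1 : ℝ) 1 × Set.Icc (-1 : ℝ) 1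

/-- Lebesgue measure on `Q = [-1,1]²`, the product of the Lebesgue measures of `[-1,1]`. -/
noncomputable def squareMeasure : Measure Square :=
  (Measure.comap ((↑) : Set.Icc (-1 : ℝ) 1 → ℝ) volume).prod
    (Measure.comap ((↑) : Set.Icc (-1 : ℝ) 1 → ℝ) volume)

/-- The space `L₂(Q)`. -/
abbrev L2Square : Type := Lp ℝ 2 squareMeasure

/-- The orthonormal Legendre polynomial
`φ_k(t) = √(k+1/2) (2^k k!)⁻¹ (d/dt)^k (t²-1)^k` on `[-1,1]`. -/
noncomputable def legendre (k : ℕ) : Polynomial ℝ :=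
  Polynomial.C (Real.sqrt ((k : ℝ) + 1 / 2) * ((2 : ℝ) ^ k * (k ! : ℝ))⁻¹) *
    Polynomial.derivative^[k] ((Polynomial.X ^ 2 - 1) ^ k)

/-- The Fourier-Legendre coefficient `⟨f, φ_{k,j}⟩ = ∫∫_Q f(t,τ) φ_k(t) φ_j(τ) dτ dt`,
with `i = (k, j)`. -/
noncomputable def fourierLegendre (f : L2Square) (i : ℕ × ℕ) : ℝ :=
  ∫ x : Square, f x * (legendre i.1).eval (x.1 : ℝ) * (legendre i.2).eval (x.2 : ℝ)
    ∂squareMeasure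

/-- The summands `max(1, k j)^{s μ} |⟨f, φ_{k,j}⟩|^s` of `‖f‖_{s,μ}^s`. -/
noncomputable def weightedTerm (s μ : ℝ) (f : L2Square) (i : ℕ × ℕ) : ℝ :=
  (max 1 ((i.1 : ℝ) * (i.2 : ℝ))) ^ (s * μ) * |fourierLegendre f i| ^ s

/-- The norm `‖f‖_{s,μ}` (meaningful for `f` in the space, i.e. when the series converges). -/
noncomputable def weightedNorm (s μ : ℝ) (f : L2Square) : ℝ :=
  (∑' i : ℕ × ℕ, weightedTerm s μ f i) ^ (1 / s)

/-- The class `L^μ_{s,2}`: the functions of the space `L^μ_{s,2}(Q)` with `‖f‖_{s,μ} ≤ 1`. -/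
def smoothnessClass (s μ : ℝ) : Set L2Square :=
  {f | Summable (weightedTerm s μ f) ∧ weightedNorm s μ f ≤ 1}

/-- The function `(t,τ) ↦ φ_k^{(r)}(t) φ_j^{(r)}(τ)` in `C(Q)`, with `i = (k, j)`. -/
noncomputable def legendreDeriv (r : ℕ) (i : ℕ × ℕ) : C(Square, ℝ) where
  toFun x := (Polynomial.derivative^[r] (legendre i.1)).eval (x.1 : ℝ) *
    (Polynomial.derivative^[r] (legendre i.2)).eval (x.2 : ℝ)
  continuous_toFun := by fun_prop

/-- The terms, `k, j ≥ r`, of the series that defines the mixed derivative `f^{(r,r)}`. -/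
noncomputable def mixedDerivTerm (r : ℕ) (f : L2Square) (i : Set.Ici ((r, r) : ℕ × ℕ)) :
    C(Square, ℝ) :=
  fourierLegendre f i • legendreDeriv r i

/-- The mixed derivative
`f^{(r,r)} = ∑_{k,j ≥ r} ⟨f, φ_{k,j}⟩ φ_k^{(r)} φ_j^{(r)}`, as a series in `C(Q)`
with the uniform norm. -/
noncomputable def mixedDeriv (r : ℕ) (f : L2Square) : C(Square, ℝ) :=
  ∑' i : Set.Ici ((r, r) : ℕ × ℕ), mixedDerivTerm r f i

/-- The hyperbolic cross `Γ_n = {(k,j) : k j ≤ r n - 1, k, j = r, …, n-1}`. -/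
def hyperbolicCross (r n : ℕ) : Finset (ℕ × ℕ) :=
  (Finset.Ico r n ×ˢ Finset.Ico r n).filter fun i => i.1 * i.2 < r * n

/-- The truncation method `D_n^{(r,r)}`, applied to a sequence `y` of (perturbed)
Fourier-Legendre coefficients; it uses only those with index in `Γ_n`. -/
noncomputable def truncation (r n : ℕ) (y : ℕ × ℕ → ℝ) : C(Square, ℝ) :=
  ∑ i ∈ hyperbolicCross r n, y i • legendreDeriv r i

/-- `y` is a perturbation of the coefficients of `f` with error at most `δ` in `ℓ_p`. -/
def IsPerturbation (p : ℝ≥0∞) (δ : ℝ) (f : L2Square) (y : ℕ × ℕ → ℝ) : Prop :=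
  ∃ ξ : lp (fun _ : ℕ × ℕ => ℝ) p, (∀ i, ξ i = fourierLegendre f i - y i) ∧ ‖ξ‖ ≤ δ

/-- The quantity `(δ⁻¹ ln^{1/p-1/s}(1/δ))^{1/(μ-1/p+1/s)}` to which the discretization parameter
`n` is matched; `p⁻¹.toReal` is `1/p`, which is `0` for `p = ∞`. -/
noncomputable def truncationLevel (s μ : ℝ) (p : ℝ≥0∞) (δ : ℝ) : ℝ :=
  (δ⁻¹ * Real.log (1 / δ) ^ (p⁻¹.toReal - 1 / s)) ^ (1 / (μ - p⁻¹.toReal + 1 / s))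

/-! On `[-1,1]`, `|φ_k^{(r)}| ≤ 2 k^{2r+1/2}`, so a basis function of index `(k,j)` has uniform norm
at most `4 (kj)^{2r+1/2}`. This bound and the weight of the class depend on `kj` alone, so a
hyperbolic cross is the natural truncation. The error splits into a tail and propagated noise.

Put `β = μ-2r+1/s-3/2`, `γ = μ-1/p+1/s`, `L = ln(1/δ)`. The tail lives on `kj ≥ rn`. Hölder with
exponent `s`, after a factor `(kj)^{-(1+ε)}` is split off for summability (Rankin's trick), and the
choice `ε ≈ 1/ln n` bound it by a multiple of `n^{-β} (ln n)^{2-1/s}` for large `n`. The noise is at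
most `δ` times the largest basis norm, `O(n^{2r+1/2})`, times `card(Γ_n)^{1-1/p}`, by Hölder in
`ℓ_p`.

Since `card(Γ_n) = O(n ln n)` and `2r+1/2+1-1/p = γ-β`, the noise is `O(n^{-β} δ n^γ (ln
n)^{1-1/p})`. An admissible `n` has `n^γ ≍ δ⁻¹ L^{1/p-1/s}`, which cancels `δ`, and `ln n = O(L)`.
Both terms then fit under `n^{-β} L^{2-1/s}`. The size of `Γ_n` comes from harmonic sums. -/

section LegendreBound

/-! ### Uniform bounds for derivatives of Legendre polynomials -/

open Polynomial

/-- The differential equation of the derivatives of `(X ^ 2 - 1) ^ k`. -/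
theorem ode_iterate_derivative_sq_sub_one_pow (k m : ℕ) :
    ((X : ℝ[X]) ^ 2 - 1) * derivative^[m + 2] ((X ^ 2 - 1) ^ k) +
      2 * C ((m : ℝ) + 1 - k) * X * derivative^[m + 1] ((X ^ 2 - 1) ^ k) +
      C (((m : ℝ) + 1) * (m - 2 * k)) * derivative^[m] ((X ^ 2 - 1) ^ k) = 0 := by
  have hC : (C (2 : ℝ) : ℝ[X]) = 2 := map_ofNat C 2
  induction m with
  | zero =>
    -- The first-order equation `(X² - 1) u' = 2kXu` of `u = (X² - 1)^k`; its derivative is the case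
    -- `m = 0`.
    have h : ((X : ℝ[X]) ^ 2 - 1) * derivative ((X ^ 2 - 1) ^ k) -
        2 * C (k : ℝ) * X * (X ^ 2 - 1) ^ k = 0 := by
      rcases k with _ | k
      · simp
      · simp only [derivative_pow, derivative_sub, derivative_X, derivative_one]
        simp [hC]
        ring
    have h2 := congrArg derivative h
    simp only [derivative_sub, derivative_mul, derivative_pow _ 2, derivative_X, derivative_one,
      derivative_C, derivative_zero, derivative_ofNat] at h2
    simp only [Function.iterate_succ', Function.comp, Function.iterate_zero, id]
    simp [hC] at h2 ⊢
    linear_combination h2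
  | succ m ih =>
    have h2 := congrArg derivative ih
    simp only [derivative_sub, derivative_add, derivative_mul, derivative_pow _ 2, derivative_X,
      derivative_one, derivative_C, derivative_zero, derivative_ofNat,
      ← Function.iterate_succ_apply' derivative] at h2
    simp [hC] at h2 ⊢
    linear_combination h2

/-- If `(1 - x²) y'' - 2 (a + 1/2) x y' + Λ y = 0` with `a, Λ` positive, then `|y|` attains its
maximum over `[-1, 1]` at an end point. -/
theorem sq_eval_le_of_ode {y : ℝ[X]} {a Λ M : ℝ} (ha : 1 / 2 ≤ a) (hΛ : 0 < Λ)
    (hode : ∀ x : ℝ, (x ^ 2 - 1) * (derivative (derivative y)).eval x +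
      2 * a * x * (derivative y).eval x - Λ * y.eval x = 0)
    (h1 : y.eval 1 ^ 2 ≤ M) (h2 : y.eval (-1) ^ 2 ≤ M) {x : ℝ} (hx : x ∈ Set.Icc (-1 : ℝ) 1) :
    y.eval x ^ 2 ≤ M := by
  -- Sonin's function: it dominates `y²`, equals it at `±1`, and by the equation its derivative has
  -- the sign of `x`.
  set E : ℝ → ℝ := fun x => y.eval x ^ 2 + (1 - x ^ 2) / Λ * (derivative y).eval x ^ 2 with hE
  have hd (x : ℝ) : HasDerivAt E ((4 * a - 2) / Λ * x * (derivative y).eval x ^ 2) x := by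
    have h := ((y.hasDerivAt x).pow 2).add
      ((((hasDerivAt_id x).pow 2).const_sub 1 |>.div_const Λ).mul
        (((derivative y).hasDerivAt x).pow 2))
    refine h.congr_deriv ?_
    have := hode x
    simp
    field_simp
    linear_combination (-2 * (derivative y).eval x) * this
  have hc : Continuous E := continuous_iff_continuousAt.2 fun x => (hd x).continuousAt
  have hle : y.eval x ^ 2 ≤ E x := by
    have : 0 ≤ (1 - x ^ 2) / Λ * (derivative y).eval x ^ 2 := by
      have : 0 ≤ 1 - x ^ 2 := by nlinarith [hx.1, hx.2]
      positivity
    simp only [hE]; linarith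
  refine hle.trans ?_
  have ha' : 0 ≤ (4 * a - 2) / Λ := div_nonneg (by linarith) hΛ.le
  rcases le_total 0 x with h0 | h0
  · have hm : MonotoneOn E (Set.Icc 0 1) := by
      refine monotoneOn_of_deriv_nonneg (convex_Icc 0 1) hc.continuousOn
        (fun z _ => (hd z).differentiableAt.differentiableWithinAt) fun z hz => ?_
      rw [interior_Icc] at hz
      rw [(hd z).deriv]
      have := hz.1
      positivity
    have := hm ⟨h0, hx.2⟩ (Set.right_mem_Icc.2 zero_le_one) hx.2
    refine this.trans ?_
    simpa [hE] using h1
  · have hm : AntitoneOn E (Set.Icc (-1) 0) := by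
      refine antitoneOn_of_deriv_nonpos (convex_Icc _ _) hc.continuousOn
        (fun z _ => (hd z).differentiableAt.differentiableWithinAt) fun z hz => ?_
      rw [interior_Icc] at hz
      rw [(hd z).deriv]
      have := mul_nonneg (mul_nonneg ha' (neg_nonneg.2 hz.2.le))
        (sq_nonneg ((derivative y).eval z))
      linarith
    have := hm (Set.left_mem_Icc.2 (by norm_num)) ⟨hx.1, h0⟩ hx.1
    refine this.trans ?_
    simpa [hE] using h2

/-- At `e = ±1` the leading coefficient of the differential equation vanishes, so each derivative is
an explicit multiple of the previous one, with factor at most `k²` in modulus. The induction starts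
from the value `k! (2e)^k`. Squares treat both signs of `e` at once. -/
theorem sq_eval_iterate_derivative_sq_sub_one_pow (k r : ℕ) (hrk : r ≤ k) {e : ℝ}
    (he : e ^ 2 = 1) :
    (derivative^[k + r] (((X : ℝ[X]) ^ 2 - 1) ^ k)).eval e ^ 2 ≤
      ((k : ℝ) ^ (2 * r) * (2 ^ k * k !)) ^ 2 := by
  induction r with
  | zero =>
    have hf : ((X : ℝ[X]) ^ 2 - 1) ^ k = (X - C e) ^ k * (X + C e) ^ k := by
      rw [← mul_pow]
      congr 1
      have : (C e : ℝ[X]) ^ 2 = 1 := by rw [← C_pow, he, C_1]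
      linear_combination this
    have h := aeval_iterate_derivative_self (A := ℝ) ((((X : ℝ[X]) ^ 2 - 1) ^ k)) k e
      (p' := (X + C e) ^ k) (by simpa using hf)
    simp only [coe_aeval_eq_eval] at h
    rw [add_zero, h]
    simp only [eval_pow, eval_add, eval_X, eval_C, nsmul_eq_mul, mul_zero, pow_zero, one_mul]
    rw [← two_mul, mul_pow, mul_pow, mul_pow, ← pow_mul e, mul_comm k 2, pow_mul e, he]
    simp only [one_pow, mul_one]
    exact le_of_eq (by ring)
  | succ r ih =>
    have ih := ih (by omega)
    have h := congrArg (eval e) (ode_iterate_derivative_sq_sub_one_pow k (k + r))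
    simp only [eval_add, eval_mul, eval_sub, eval_pow, eval_X, eval_one, eval_C, he, eval_zero,
      eval_ofNat] at h
    rw [← add_assoc]
    set y := (derivative^[k + r] (((X : ℝ[X]) ^ 2 - 1) ^ k)).eval e
    set z := (derivative^[k + r + 1] (((X : ℝ[X]) ^ 2 - 1) ^ k)).eval e
    push_cast at h
    have hz : (2 * ((r : ℝ) + 1)) ^ 2 * z ^ 2 = (((k : ℝ) + r + 1) * (k - r)) ^ 2 * y ^ 2 := by
      have h1 : 2 * ((r : ℝ) + 1) * e * z = ((k : ℝ) + r + 1) * (k - r) * y := by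
        linear_combination h
      have := congrArg (· ^ 2) h1
      simp only [mul_pow, he] at this ⊢
      linarith
    have hk : ((r : ℝ) + 1) ≤ k := by exact_mod_cast hrk
    have h3 : (((k : ℝ) + r + 1) * (k - r)) ^ 2 ≤ (2 * k ^ 2) ^ 2 := by
      have h0 : (0 : ℝ) ≤ r := r.cast_nonneg
      apply pow_le_pow_left₀
      · exact mul_nonneg (by linarith) (by linarith)
      · nlinarith
    have h4 : 2 ^ 2 * z ^ 2 ≤ (2 * (k : ℝ) ^ 2) ^ 2 * ((k : ℝ) ^ (2 * r) * (2 ^ k * k !)) ^ 2 :=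
      calc 2 ^ 2 * z ^ 2 ≤ (2 * ((r : ℝ) + 1)) ^ 2 * z ^ 2 := by
            gcongr
            nlinarith [(Nat.cast_nonneg r : (0 : ℝ) ≤ r)]
        _ = _ := hz
        _ ≤ _ := by gcongr
    have h5 : (k : ℝ) ^ (2 * (r + 1)) = k ^ 2 * k ^ (2 * r) := by ring
    rw [h5]
    nlinarith

theorem abs_eval_iterate_derivative_legendre_le {k r : ℕ} (hr : 1 ≤ r) (hrk : r ≤ k) {x : ℝ}
    (hx : x ∈ Set.Icc (-1 : ℝ) 1) :
    |(derivative^[r] (legendre k)).eval x| ≤ 2 * (k : ℝ) ^ (2 * (r : ℝ) + 1 / 2) := by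
  have hk1 : (1 : ℝ) ≤ k := by exact_mod_cast hr.trans hrk
  have hM : (derivative^[k + r] (((X : ℝ[X]) ^ 2 - 1) ^ k)).eval x ^ 2 ≤
      ((k : ℝ) ^ (2 * r) * (2 ^ k * k !)) ^ 2 := by
    have b1 := sq_eval_iterate_derivative_sq_sub_one_pow k r hrk (e := 1) (by norm_num)
    have b2 := sq_eval_iterate_derivative_sq_sub_one_pow k r hrk (e := -1) (by norm_num)
    -- For `r = k` the constant `Λ = (k+r+1)(k-r)` is zero and the Sonin argument is unavailable,
    -- but the polynomial is then constant.
    rcases hrk.eq_or_lt with rfl | hlt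
    · have hdeg : (derivative^[r + r] (((X : ℝ[X]) ^ 2 - 1) ^ r)).natDegree = 0 := by
        have h1 := natDegree_iterate_derivative (((X : ℝ[X]) ^ 2 - 1) ^ r) (r + r)
        have h2 : (((X : ℝ[X]) ^ 2 - 1) ^ r).natDegree ≤ r * 2 := by
          refine natDegree_pow_le_of_le r ?_
          compute_degree
        omega
      rw [eq_C_of_natDegree_eq_zero hdeg] at b1 ⊢
      simpa using b1
    · refine sq_eval_le_of_ode (a := (r : ℝ) + 1) (Λ := ((k : ℝ) + r + 1) * (k - r))
        (by linarith [(Nat.cast_nonneg r : (0 : ℝ) ≤ r)]) ?_ (fun z => ?_) b1 b2 hx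
      · have : (r : ℝ) < k := by exact_mod_cast hlt
        exact mul_pos (by positivity) (by linarith)
      · have h := congrArg (eval z) (ode_iterate_derivative_sq_sub_one_pow k (k + r))
        simp only [eval_add, eval_mul, eval_sub, eval_pow, eval_X, eval_one, eval_C, eval_zero,
          eval_ofNat] at h
        simp only [← Function.iterate_succ_apply' derivative]
        push_cast at h
        linear_combination h
  have hq : |(derivative^[k + r] (((X : ℝ[X]) ^ 2 - 1) ^ k)).eval x| ≤
      (k : ℝ) ^ (2 * r) * (2 ^ k * k !) :=
    abs_le_of_sq_le_sq hM (by positivity)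
  unfold legendre
  rw [iterate_derivative_C_mul, ← Function.iterate_add_apply, eval_mul, eval_C, abs_mul,
    add_comm r k, abs_of_nonneg (by positivity)]
  have hpos : (0 : ℝ) < 2 ^ k * k ! := by positivity
  have hsq : Real.sqrt ((k : ℝ) + 1 / 2) ≤ 2 * (k : ℝ) ^ (1 / 2 : ℝ) := by
    rw [← Real.sqrt_eq_rpow, Real.sqrt_le_left (by positivity), mul_pow, Real.sq_sqrt (by positivity)]
    linarith
  calc Real.sqrt ((k : ℝ) + 1 / 2) * ((2 : ℝ) ^ k * (k ! : ℝ))⁻¹ *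
        |(derivative^[k + r] (((X : ℝ[X]) ^ 2 - 1) ^ k)).eval x|
      ≤ (2 * (k : ℝ) ^ (1 / 2 : ℝ)) * ((2 : ℝ) ^ k * (k ! : ℝ))⁻¹ * ((k : ℝ) ^ (2 * r) * (2 ^ k * k !)) := by
        gcongr
    _ = 2 * ((k : ℝ) ^ (2 * r) * (k : ℝ) ^ (1 / 2 : ℝ)) := by field_simp
    _ = 2 * (k : ℝ) ^ (2 * (r : ℝ) + 1 / 2) := by
        rw [Real.rpow_add (by linarith), ← Real.rpow_natCast]
        push_cast
        rfl

end LegendreBound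

theorem norm_legendreDeriv_le {r : ℕ} (hr : 1 ≤ r) {i : ℕ × ℕ} (hi : (r, r) ≤ i) :
    ‖legendreDeriv r i‖ ≤ 4 * ((i.1 : ℝ) * i.2) ^ (2 * (r : ℝ) + 1 / 2) := by
  rw [ContinuousMap.norm_le _ (by positivity)]
  intro x
  have h1 := abs_eval_iterate_derivative_legendre_le hr hi.1 x.1.2
  have h2 := abs_eval_iterate_derivative_legendre_le hr hi.2 x.2.2
  rw [Real.mul_rpow (by positivity) (by positivity), Real.norm_eq_abs]
  have h3 := mul_le_mul h1 h2 (abs_nonneg _) (by positivity)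
  rw [← abs_mul] at h3
  exact h3.trans_eq (by ring)

/-! ### Hölder estimates and power sums -/

/-- Hölder's inequality in a form that includes the exponent `1`. -/
theorem sum_mul_rpow_one_sub_le {ι : Type*} (F : Finset ι) {s A W : ℝ} (hs : 1 ≤ s)
    {a w : ι → ℝ} (ha : ∀ i ∈ F, 0 ≤ a i) (hw : ∀ i ∈ F, 0 ≤ w i) (hA : 0 ≤ A)
    (haA : ∑ i ∈ F, a i ^ s ≤ A ^ s) (hwW : ∑ i ∈ F, w i ≤ W) :
    ∑ i ∈ F, a i * w i ^ (1 - 1 / s) ≤ A * W ^ (1 - 1 / s) := by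
  rcases hs.eq_or_lt with rfl | hs1
  · simpa using haA
  have hs0 : 0 < s := by linarith
  have hpq := Real.HolderConjugate.conjExponent hs1
  have hq : 1 / s.conjExponent = 1 - 1 / s := by
    have := hpq.inv_add_inv_eq_one
    simp only [one_div]
    linarith
  refine (Real.inner_le_Lp_mul_Lq_of_nonneg F hpq ha
    fun i hi => Real.rpow_nonneg (hw i hi) _).trans ?_
  have h1 : ∑ i ∈ F, (w i ^ (1 - 1 / s)) ^ s.conjExponent = ∑ i ∈ F, w i := by
    refine Finset.sum_congr rfl fun i hi => ?_
    rw [← hq, one_div, Real.rpow_inv_rpow (hw i hi) hpq.symm.ne_zero]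
  rw [h1, hq]
  have h2 : 0 ≤ ∑ i ∈ F, a i ^ s := Finset.sum_nonneg fun i hi => Real.rpow_nonneg (ha i hi) _
  have h3 : 0 ≤ 1 - 1 / s := by
    rw [sub_nonneg, div_le_one hs0]; exact hs
  gcongr
  · exact Real.rpow_nonneg (Finset.sum_nonneg hw) _
  · calc (∑ i ∈ F, a i ^ s) ^ (1 / s) ≤ (A ^ s) ^ (1 / s) := by gcongr
      _ = A := by rw [one_div, Real.rpow_rpow_inv hA hs0.ne']
  · exact Finset.sum_nonneg hw

theorem lp_sum_norm_le {ι : Type*} {p : ℝ≥0∞} (hp : 1 ≤ p) (ξ : lp (fun _ : ι => ℝ) p)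
    (F : Finset ι) : ∑ i ∈ F, |ξ i| ≤ ‖ξ‖ * (F.card : ℝ) ^ (1 - p⁻¹.toReal) := by
  have hp0 : p ≠ 0 := (zero_lt_one.trans_le hp).ne'
  rcases eq_or_ne p ∞ with rfl | hpt
  · have := Finset.sum_le_card_nsmul F (fun i => |ξ i|) ‖ξ‖ fun i _ =>
      lp.norm_apply_le_norm hp0 ξ i
    simpa [mul_comm] using this
  have hp1 : 1 ≤ p.toReal := by
    rw [← ENNReal.toReal_one]
    exact ENNReal.toReal_mono hpt hp
  have h := sum_mul_rpow_one_sub_le F hp1 (a := fun i => |ξ i|) (w := fun _ => 1) (A := ‖ξ‖)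
    (W := F.card) (fun i _ => abs_nonneg _) (fun _ _ => zero_le_one) (lp.norm_nonneg' ξ)
    (lp.sum_rpow_le_norm_rpow (by linarith) ξ F) (by simp)
  simpa [ENNReal.toReal_inv] using h

/-- Comparison with `∫ x^{-1-ε} dx`, done by telescoping. The explicit dependence on `ε` matters,
since `ε` later tends to zero. -/
theorem sum_Icc_rpow_neg_one_add_le {ε : ℝ} (hε : 0 < ε) (M : ℕ) :
    ∑ k ∈ Finset.Icc 1 M, (k : ℝ) ^ (-(1 + ε)) ≤ 1 + 1 / ε := by
  -- Subtracting the tail integral `(M+1)^{-ε}/ε` makes the bound inductive.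
  suffices h : ∀ M : ℕ, ∑ k ∈ Finset.Icc 1 (M + 1), (k : ℝ) ^ (-(1 + ε)) ≤
      1 + 1 / ε - ((M + 1 : ℕ) : ℝ) ^ (-ε) / ε by
    rcases M with _ | M
    · simp; positivity
    · have : 0 ≤ ((M + 1 : ℕ) : ℝ) ^ (-ε) / ε := by positivity
      linarith [h M]
  intro M
  induction M with
  | zero => simp
  | succ M ih =>
    rw [Finset.sum_Icc_succ_top (by omega)]
    refine (add_le_add_left ih _).trans ?_
    set x : ℝ := ((M + 1 : ℕ) : ℝ) with hx
    have hx0 : 0 < x := by positivity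
    have hy : ((M + 1 + 1 : ℕ) : ℝ) = x + 1 := by push_cast [hx]; ring
    rw [hy]
    have hy0 : 0 < x + 1 := by linarith
    have h1 : 1 + ε / (x + 1) ≤ (x / (x + 1)) ^ (-ε) := by
      rw [Real.rpow_def_of_pos (by positivity)]
      have h2 := Real.add_one_le_exp (Real.log (x / (x + 1)) * -ε)
      have h3 := Real.log_le_sub_one_of_pos (show 0 < x / (x + 1) by positivity)
      have h4 : x / (x + 1) - 1 = -(1 / (x + 1)) := by field_simp; ring
      rw [h4] at h3
      have h5 : ε / (x + 1) = 1 / (x + 1) * ε := by ring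
      nlinarith
    rw [Real.div_rpow hx0.le hy0.le, le_div_iff₀ (by positivity)] at h1
    have h6 : (x + 1) ^ (-(1 + ε)) = (x + 1) ^ (-ε) / (x + 1) := by
      rw [← Real.rpow_sub_one hy0.ne']
      congr 1; ring
    have h7 : (x + 1) ^ (-(1 + ε)) * ε ≤ x ^ (-ε) - (x + 1) ^ (-ε) := by
      rw [h6]
      calc _ = (1 + ε / (x + 1)) * (x + 1) ^ (-ε) - (x + 1) ^ (-ε) := by field_simp; ring
        _ ≤ _ := by linarith
    rw [← le_div_iff₀ hε, sub_div] at h7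
    linarith

theorem sum_mul_rpow_neg_one_add_le {ε : ℝ} (hε : 0 < ε) (F : Finset (ℕ × ℕ))
    (hF : ∀ i ∈ F, 1 ≤ i.1 ∧ 1 ≤ i.2) :
    ∑ i ∈ F, ((i.1 : ℝ) * i.2) ^ (-(1 + ε)) ≤ (1 + 1 / ε) ^ 2 := by
  set M := F.sup fun i => max i.1 i.2
  have hsub : F ⊆ Finset.Icc 1 M ×ˢ Finset.Icc 1 M := fun i hi => by
    have h := Finset.le_sup (f := fun i : ℕ × ℕ => max i.1 i.2) hi
    have h' := hF i hi
    rw [max_le_iff] at h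
    simp only [Finset.mem_product, Finset.mem_Icc]
    exact ⟨⟨h'.1, h.1⟩, h'.2, h.2⟩
  calc _ ≤ ∑ i ∈ Finset.Icc 1 M ×ˢ Finset.Icc 1 M, ((i.1 : ℝ) * i.2) ^ (-(1 + ε)) :=
        Finset.sum_le_sum_of_subset_of_nonneg hsub fun i _ _ => by positivity
    _ = (∑ k ∈ Finset.Icc 1 M, (k : ℝ) ^ (-(1 + ε))) ^ 2 := by
        rw [sq, Finset.sum_mul_sum, Finset.sum_product]
        refine Finset.sum_congr rfl fun k _ => Finset.sum_congr rfl fun j _ => ?_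
        exact Real.mul_rpow (by positivity) (by positivity)
    _ ≤ _ := by
        gcongr
        exact sum_Icc_rpow_neg_one_add_le hε M

/-! ### The tail outside a hyperbolic cross -/

theorem sum_weightedTerm_le_one {s μ : ℝ} (hs : 1 ≤ s) {f : L2Square}
    (hf : f ∈ smoothnessClass s μ) (F : Finset (ℕ × ℕ)) : ∑ i ∈ F, weightedTerm s μ f i ≤ 1 := by
  have h0 (i : ℕ × ℕ) : 0 ≤ weightedTerm s μ f i := by unfold weightedTerm; positivity
  refine (hf.1.sum_le_tsum F fun i _ => h0 i).trans ?_
  have h := hf.2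
  unfold weightedNorm at h
  by_contra! hlt
  exact absurd h (not_le.2 (Real.one_lt_rpow hlt (by positivity)))

/-- Rankin's trick for the part of the derivative outside of a hyperbolic cross. -/
theorem sum_norm_smul_legendreDeriv_le {r : ℕ} (hr : 1 ≤ r) {s μ β ε N : ℝ} (hs : 1 ≤ s)
    (hβ : β = μ - 2 * r + 1 / s - 3 / 2) (hε : 0 < ε) (hεβ : ε ≤ β) (hN : 1 ≤ N) {f : L2Square}
    (hf : f ∈ smoothnessClass s μ) (F : Finset (ℕ × ℕ))
    (hF : ∀ i ∈ F, (r, r) ≤ i ∧ N ≤ (i.1 : ℝ) * i.2) :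
    ∑ i ∈ F, ‖fourierLegendre f i • legendreDeriv r i‖ ≤
      4 * N ^ (-β + ε * (1 - 1 / s)) * ((1 + 1 / ε) ^ 2) ^ (1 - 1 / s) := by
  have hs0 : 0 < s := by linarith
  have h1s : 1 / s ≤ 1 := by rw [div_le_one hs0]; exact hs
  have h1s0 : 0 < 1 / s := by positivity
  have h := sum_mul_rpow_one_sub_le F hs
    (a := fun i => ((i.1 : ℝ) * i.2) ^ μ * |fourierLegendre f i|)
    (w := fun i => ((i.1 : ℝ) * i.2) ^ (-(1 + ε))) (A := 1) (W := (1 + 1 / ε) ^ 2)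
    (fun i _ => by positivity) (fun i _ => by positivity) zero_le_one ?_ ?_
  · rw [one_mul] at h
    refine le_trans ?_ (mul_le_mul_of_nonneg_left h
      (show 0 ≤ 4 * N ^ (-β + ε * (1 - 1 / s)) by positivity))
    rw [Finset.mul_sum]
    refine Finset.sum_le_sum fun i hi => ?_
    obtain ⟨hir, hiN⟩ := hF i hi
    set z : ℝ := (i.1 : ℝ) * i.2
    have hz : 0 < z := by linarith
    rw [norm_smul, Real.norm_eq_abs]
    calc |fourierLegendre f i| * ‖legendreDeriv r i‖
        ≤ |fourierLegendre f i| * (4 * z ^ (2 * (r : ℝ) + 1 / 2)) := by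
          gcongr
          exact norm_legendreDeriv_le hr hir
      _ = 4 * z ^ (-β + ε * (1 - 1 / s)) *
            (z ^ μ * |fourierLegendre f i| * (z ^ (-(1 + ε))) ^ (1 - 1 / s)) := by
          have : z ^ (2 * (r : ℝ) + 1 / 2) =
              z ^ (-β + ε * (1 - 1 / s)) * (z ^ μ * z ^ (-(1 + ε) * (1 - 1 / s))) := by
            rw [← Real.rpow_add hz, ← Real.rpow_add hz]
            congr 1
            rw [hβ]; ring
          rw [← Real.rpow_mul hz.le, this]
          ring
      -- The exponent `-β + ε(1 - 1/s)` is nonpositive because `ε ≤ β`, so `z ≥ N` may be replaced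
      -- by `N`.
      _ ≤ _ := by
          gcongr ?_ * ?_
          gcongr ?_ * ?_
          refine Real.rpow_le_rpow_of_nonpos (by linarith) hiN ?_
          nlinarith
  · rw [Real.one_rpow]
    refine le_trans (Finset.sum_le_sum fun i hi => ?_) (sum_weightedTerm_le_one hs hf F)
    unfold weightedTerm
    have hz : 1 ≤ (i.1 : ℝ) * i.2 := hN.trans (hF i hi).2
    rw [max_eq_right hz, Real.mul_rpow (by positivity) (by positivity),
      ← Real.rpow_mul (by positivity), mul_comm μ s]
  · exact sum_mul_rpow_neg_one_add_le hε F fun i hi =>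
      ⟨hr.trans (hF i hi).1.1, hr.trans (hF i hi).1.2⟩

theorem sum_norm_smul_legendreDeriv_le_log {r : ℕ} (hr : 1 ≤ r) {s μ β N : ℝ} (hs : 1 ≤ s)
    (hβ : β = μ - 2 * r + 1 / s - 3 / 2) (hβ0 : 0 < β) (hN : 1 ≤ N) {f : L2Square}
    (hf : f ∈ smoothnessClass s μ) (F : Finset (ℕ × ℕ))
    (hF : ∀ i ∈ F, (r, r) ≤ i ∧ N ≤ (i.1 : ℝ) * i.2) :
    ∑ i ∈ F, ‖fourierLegendre f i • legendreDeriv r i‖ ≤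
      4 * Real.exp 1 * N ^ (-β) * (2 + 1 / β + Real.log N) ^ (2 - 1 / s) := by
  have hs0 : 0 < s := by linarith
  have h1s : 1 / s ≤ 1 := by rw [div_le_one hs0]; exact hs
  have h1s0 : 0 < 1 / s := by positivity
  have hl : 0 ≤ Real.log N := Real.log_nonneg hN
  have hN0 : 0 < N := by linarith
  -- This choice keeps `N^ε ≤ e` while `1/ε` grows only like `ln N`; the minimum with `β` secures `ε
  -- ≤ β`.
  set ε := min β (1 / (1 + Real.log N)) with hε
  have hε0 : 0 < ε := lt_min hβ0 (by positivity)
  refine (sum_norm_smul_legendreDeriv_le hr hs hβ hε0 (min_le_left _ _) hN hf F hF).trans ?_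
  have h1 : N ^ (ε * (1 - 1 / s)) ≤ Real.exp 1 := by
    rw [Real.rpow_def_of_pos hN0, Real.exp_le_exp]
    have h2 : ε ≤ 1 / (1 + Real.log N) := min_le_right _ _
    rw [le_div_iff₀ (by positivity)] at h2
    have h3 : 0 ≤ Real.log N * ε := by positivity
    nlinarith
  have h2 : 1 + 1 / ε ≤ 2 + 1 / β + Real.log N := by
    have : 0 < 1 / β := by positivity
    rcases min_choice β (1 / (1 + Real.log N)) with h | h
    · rw [hε, h]; linarith
    · rw [hε, h, one_div_one_div]; linarith
  have h3 : ((1 + 1 / ε) ^ 2) ^ (1 - 1 / s) ≤ (2 + 1 / β + Real.log N) ^ (2 - 1 / s) := by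
    have h4 : 1 ≤ 1 + 1 / ε := by
      have : 0 < 1 / ε := by positivity
      linarith
    rw [← Real.rpow_natCast, ← Real.rpow_mul (by linarith)]
    -- The exponent `2 - 2/s` obtained here is relaxed to `2 - 1/s`.
    refine (Real.rpow_le_rpow_of_exponent_le h4 (?_ : _ ≤ 2 - 1 / s)).trans ?_
    · push_cast; linarith
    · exact Real.rpow_le_rpow (by linarith) h2 (by linarith)
  rw [Real.rpow_add hN0]
  calc _ ≤ 4 * (N ^ (-β) * Real.exp 1) * (2 + 1 / β + Real.log N) ^ (2 - 1 / s) := by gcongr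
    _ = _ := by ring

/-! ### Cardinality of the hyperbolic cross -/

theorem card_hyperbolicCross (r n : ℕ) : (hyperbolicCross r n).card =
    ∑ k ∈ Finset.Ico r n, ((Finset.Ico r n).filter fun j => k * j < r * n).card := by
  unfold hyperbolicCross
  simp only [Finset.card_filter]
  rw [Finset.sum_product]

theorem card_hyperbolicCross_le {r : ℕ} (hr : 1 ≤ r) (n : ℕ) :
    ((hyperbolicCross r n).card : ℝ) ≤ r * (n * (1 + Real.log n)) := by
  have h1 : ∀ k ∈ Finset.Ico r n,
      (((Finset.Ico r n).filter fun j => k * j < r * n).card : ℝ) ≤ r * n * (k : ℝ)⁻¹ := by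
    intro k hk
    have hk0 : 0 < k := lt_of_lt_of_le hr (Finset.mem_Ico.1 hk).1
    have hsub : (Finset.Ico r n).filter (fun j => k * j < r * n) ⊆
        Finset.Ioc 0 (r * n / k) := by
      intro j hj
      simp only [Finset.mem_filter, Finset.mem_Ico, Finset.mem_Ioc] at hj ⊢
      refine ⟨by omega, ?_⟩
      rw [Nat.le_div_iff_mul_le hk0, mul_comm]
      exact hj.2.le
    calc _ ≤ (((r * n / k : ℕ)) : ℝ) := by
          exact_mod_cast (Finset.card_le_card hsub).trans_eq (by simp)
      _ ≤ ((r * n : ℕ) : ℝ) / k := Nat.cast_div_le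
      _ = _ := by push_cast; rw [div_eq_mul_inv]
  rw [card_hyperbolicCross]
  push_cast
  refine (Finset.sum_le_sum h1).trans ?_
  rw [← Finset.mul_sum, mul_assoc]
  gcongr
  have h2 : Finset.Ico r n ⊆ Finset.Icc 1 n := fun k hk => by
    simp only [Finset.mem_Ico, Finset.mem_Icc] at hk ⊢
    omega
  have h3 := harmonic_le_one_add_log n
  rw [harmonic_eq_sum_Icc] at h3
  push_cast at h3
  exact (Finset.sum_le_sum_of_subset_of_nonneg h2 fun i _ _ => by positivity).trans h3

/-- For `r ≤ k ≤ n/2` the row of `k` has at least `rn/k - r ≥ n/(2k)` points. The harmonic sum over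
these `k` is at least `ln n - 1 - r`, which the hypothesis makes at least half of `ln n`. -/
theorem le_card_hyperbolicCross {r : ℕ} (hr : 1 ≤ r) {n : ℕ}
    (hn : 2 * (r + 1) ≤ Real.log n) :
    (n : ℝ) * Real.log n / 4 ≤ ((hyperbolicCross r n).card : ℝ) := by
  have hn0 : (0 : ℝ) < n := by
    rcases Nat.eq_zero_or_pos n with rfl | h
    · simp at hn
      have : (0 : ℝ) ≤ r := r.cast_nonneg
      linarith
    · exact_mod_cast h
  have hr1 : (1 : ℝ) ≤ r := by exact_mod_cast hr
  have h1 : ∀ k ∈ Finset.Icc r (n / 2),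
      (n : ℝ) / 2 * (k : ℝ)⁻¹ ≤ (((Finset.Ico r n).filter fun j => k * j < r * n).card : ℝ) := by
    intro k hk
    simp only [Finset.mem_Icc] at hk
    have hk0 : 0 < k := lt_of_lt_of_le hr hk.1
    have hk0' : (0 : ℝ) < k := by exact_mod_cast hk0
    have hkn : 2 * k ≤ n := by omega
    have hkn' : 2 * (k : ℝ) ≤ n := by exact_mod_cast hkn
    have hsub : Finset.Ico r ⌈(r * n : ℝ) / k⌉₊ ⊆
        (Finset.Ico r n).filter (fun j => k * j < r * n) := by
      intro j hj
      simp only [Finset.mem_filter, Finset.mem_Ico, Nat.lt_ceil] at hj ⊢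
      have h2 : (j : ℝ) * k < r * n := (lt_div_iff₀ hk0').1 hj.2
      have h3 : j * k < r * n := by exact_mod_cast h2
      refine ⟨⟨hj.1, ?_⟩, by rw [mul_comm]; exact h3⟩
      by_contra! hnj
      have := Nat.mul_le_mul hnj hk.1
      rw [mul_comm n r] at this
      omega
    have h4 : (⌈(r * n : ℝ) / k⌉₊ : ℝ) - r ≤
        (((Finset.Ico r n).filter fun j => k * j < r * n).card : ℝ) := by
      have := Finset.card_le_card hsub
      rw [Nat.card_Ico, Nat.sub_le_iff_le_add] at this
      have h5 : (⌈(r * n : ℝ) / k⌉₊ : ℝ) ≤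
        (((Finset.Ico r n).filter fun j => k * j < r * n).card : ℝ) + r := by exact_mod_cast this
      linarith
    refine le_trans ?_ h4
    have h5 := Nat.le_ceil ((r * n : ℝ) / k)
    have h6 : (n : ℝ) / 2 * (k : ℝ)⁻¹ ≤ (r * n : ℝ) / k - r := by
      rw [← div_eq_mul_inv, div_le_iff₀ hk0', sub_mul, div_mul_cancel₀ _ hk0'.ne']
      nlinarith
    linarith
  have h2 : Finset.Icc r (n / 2) ⊆ Finset.Ico r n := fun k hk => by
    simp only [Finset.mem_Ico, Finset.mem_Icc] at hk ⊢
    omega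
  have h3 : Real.log n - 1 - r ≤ ∑ k ∈ Finset.Icc r (n / 2), (k : ℝ)⁻¹ := by
    have h4 := log_add_one_le_harmonic (n / 2)
    rw [harmonic_eq_sum_Icc] at h4
    push_cast at h4
    have h5 : Real.log n - 1 ≤ Real.log (((n / 2 : ℕ) : ℝ) + 1) := by
      have h6 : (n : ℝ) / 2 ≤ ((n / 2 : ℕ) : ℝ) + 1 := by
        have : n ≤ 2 * (n / 2 + 1) := by omega
        have : (n : ℝ) ≤ 2 * (((n / 2 : ℕ) : ℝ) + 1) := by exact_mod_cast this
        linarith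
      have h7 := Real.log_le_log (by positivity) h6
      rw [Real.log_div hn0.ne' two_ne_zero] at h7
      linarith [Real.log_two_lt_d9]
    have h8 : ∑ k ∈ Finset.Icc 1 (n / 2), (k : ℝ)⁻¹ ≤
        ∑ k ∈ Finset.Icc 1 r ∪ Finset.Icc r (n / 2), (k : ℝ)⁻¹ := by
      refine Finset.sum_le_sum_of_subset_of_nonneg (fun k hk => ?_) fun i _ _ => by positivity
      simp only [Finset.mem_union, Finset.mem_Icc] at hk ⊢
      omega
    have h9 := Finset.sum_union_inter (s₁ := Finset.Icc 1 r) (s₂ := Finset.Icc r (n / 2))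
      (f := fun k : ℕ => (k : ℝ)⁻¹)
    have h10 : 0 ≤ ∑ k ∈ Finset.Icc 1 r ∩ Finset.Icc r (n / 2), (k : ℝ)⁻¹ :=
      Finset.sum_nonneg fun i _ => by positivity
    have h11 : ∑ k ∈ Finset.Icc 1 r, (k : ℝ)⁻¹ ≤ r := by
      refine (Finset.sum_le_card_nsmul _ _ 1 fun k hk => ?_).trans_eq (by simp)
      exact inv_le_one_of_one_le₀ (by exact_mod_cast (Finset.mem_Icc.1 hk).1)
    linarith
  rw [card_hyperbolicCross]
  push_cast
  calc (n : ℝ) * Real.log n / 4 ≤ (n : ℝ) / 2 * (Real.log n - 1 - r) := by nlinarith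
    _ ≤ (n : ℝ) / 2 * ∑ k ∈ Finset.Icc r (n / 2), (k : ℝ)⁻¹ := by gcongr
    _ = ∑ k ∈ Finset.Icc r (n / 2), (n : ℝ) / 2 * (k : ℝ)⁻¹ := by rw [Finset.mul_sum]
    _ ≤ _ := Finset.sum_le_sum h1
    _ ≤ _ := Finset.sum_le_sum_of_subset_of_nonneg h2 fun i _ _ => by positivity

/-! ### Truncation error and propagated noise -/

/-- The constraints `k, j < n` in `Γ_n` are redundant: with both indices at least `r`, they follow
from `kj < rn`. -/
theorem le_mul_of_notMem_hyperbolicCross {r n : ℕ} {i : ℕ × ℕ} (hi : (r, r) ≤ i)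
    (hin : i ∉ hyperbolicCross r n) : r * n ≤ i.1 * i.2 := by
  by_contra! h
  have h1 : r ≤ i.1 := hi.1
  have h2 : r ≤ i.2 := hi.2
  have h3 : i.1 < n := by
    by_contra! h'
    have := Nat.mul_le_mul h' h2
    rw [mul_comm n r] at this
    omega
  have h4 : i.2 < n := by
    by_contra! h'
    have := Nat.mul_le_mul h1 h'
    omega
  exact hin (by simp [hyperbolicCross, h, h1, h2, h3, h4])

theorem mem_hyperbolicCross_bounds {r n : ℕ} {i : ℕ × ℕ} (hi : i ∈ hyperbolicCross r n) :
    (r, r) ≤ i ∧ i.1 * i.2 < r * n := by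
  simp only [hyperbolicCross, Finset.mem_filter, Finset.mem_product, Finset.mem_Ico] at hi
  exact ⟨⟨hi.1.1.1, hi.1.2.1⟩, hi.2⟩

theorem summable_mixedDerivTerm {r : ℕ} (hr : 1 ≤ r) {s μ : ℝ} (hs : 1 ≤ s)
    (hμ : 2 * (r : ℝ) - 1 / s + 3 / 2 < μ) {f : L2Square} (hf : f ∈ smoothnessClass s μ) :
    Summable (mixedDerivTerm r f) := by
  refine Summable.of_norm (summable_of_sum_le (fun i => norm_nonneg (mixedDerivTerm r f i))
    (c := 4 * Real.exp 1 * 1 ^ (-(μ - 2 * r + 1 / s - 3 / 2)) *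
      (2 + 1 / (μ - 2 * r + 1 / s - 3 / 2) + Real.log 1) ^ (2 - 1 / s)) fun u => ?_)
  have h := sum_norm_smul_legendreDeriv_le_log hr hs rfl (by linarith) le_rfl hf
    (u.map (Function.Embedding.subtype _)) fun i hi => ?_
  · rw [Finset.sum_map] at h
    exact h
  · simp only [Finset.mem_map, Function.Embedding.subtype_apply] at hi
    obtain ⟨j, _, rfl⟩ := hi
    have h1 : (r, r) ≤ (j : ℕ × ℕ) := j.2
    have h2 : 1 ≤ (j : ℕ × ℕ).1 := hr.trans h1.1
    have h3 : 1 ≤ (j : ℕ × ℕ).2 := hr.trans h1.2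
    exact ⟨h1, by exact_mod_cast Nat.mul_le_mul h2 h3⟩

theorem norm_mixedDeriv_sub_truncation_le {r : ℕ} (hr : 1 ≤ r) {s μ β : ℝ} (hs : 1 ≤ s)
    (hβ : β = μ - 2 * r + 1 / s - 3 / 2) (hβ0 : 0 < β) {f : L2Square}
    (hf : f ∈ smoothnessClass s μ) {n : ℕ} (hn : 1 ≤ n) :
    ‖mixedDeriv r f - truncation r n (fourierLegendre f)‖ ≤
      4 * Real.exp 1 * (n : ℝ) ^ (-β) * (2 + 1 / β + Real.log n) ^ (2 - 1 / s) := by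
  have hsum := (summable_mixedDerivTerm hr hs (by linarith) hf).hasSum
  set S : Finset (Set.Ici ((r, r) : ℕ × ℕ)) :=
    (hyperbolicCross r n).subtype fun i => i ∈ Set.Ici ((r, r) : ℕ × ℕ) with hS
  have hSt : ∑ i ∈ S, mixedDerivTerm r f i = truncation r n (fourierLegendre f) := by
    unfold truncation
    exact Finset.sum_subtype_of_mem (p := fun i => i ∈ Set.Ici ((r, r) : ℕ × ℕ))
      (fun i => fourierLegendre f i • legendreDeriv r i)
      fun i hi => (mem_hyperbolicCross_bounds hi).1
  rw [← hSt]
  -- Partial sums over sets containing `Γ_n` differ from the truncation by a finite sum outside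
  -- `Γ_n`, to which the tail bound applies uniformly.
  refine le_of_tendsto (hsum.sub_const _).norm ?_
  filter_upwards [Filter.eventually_ge_atTop S] with T hT
  rw [← Finset.sum_sdiff hT, add_sub_cancel_right]
  refine (norm_sum_le _ _).trans ?_
  have h := sum_norm_smul_legendreDeriv_le_log hr hs hβ hβ0
    (show (1 : ℝ) ≤ n by exact_mod_cast hn) hf
    ((T \ S).map (Function.Embedding.subtype _)) fun i hi => ?_
  · rw [Finset.sum_map] at h
    exact h
  · simp only [Finset.mem_map, Function.Embedding.subtype_apply, Finset.mem_sdiff] at hi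
    obtain ⟨j, ⟨_, hj⟩, rfl⟩ := hi
    have h1 : (r, r) ≤ (j : ℕ × ℕ) := j.2
    refine ⟨h1, ?_⟩
    have h2 : (j : ℕ × ℕ) ∉ hyperbolicCross r n := fun h => hj (by simp [hS, h])
    have h3 := le_mul_of_notMem_hyperbolicCross h1 h2
    exact_mod_cast (Nat.le_mul_of_pos_left n hr).trans h3

theorem norm_truncation_sub_le {r : ℕ} (hr : 1 ≤ r) {p : ℝ≥0∞} (hp : 1 ≤ p) {δ : ℝ}
    {f : L2Square} {y : ℕ × ℕ → ℝ} (hy : IsPerturbation p δ f y) (n : ℕ) :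
    ‖truncation r n (fourierLegendre f) - truncation r n y‖ ≤
      4 * ((r : ℝ) * n) ^ (2 * (r : ℝ) + 1 / 2) *
        (δ * (r * (n * (1 + Real.log n))) ^ (1 - p⁻¹.toReal)) := by
  obtain ⟨ξ, hξ, hδ⟩ := hy
  have hp1 : p⁻¹.toReal ≤ 1 := by
    rw [← ENNReal.toReal_one]
    exact ENNReal.toReal_mono ENNReal.one_ne_top (ENNReal.inv_le_one.2 hp)
  unfold truncation
  rw [← Finset.sum_sub_distrib]
  refine (norm_sum_le _ _).trans ?_
  calc ∑ i ∈ hyperbolicCross r n, ‖fourierLegendre f i • legendreDeriv r i - y i • legendreDeriv r i‖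
      ≤ ∑ i ∈ hyperbolicCross r n, 4 * ((r : ℝ) * n) ^ (2 * (r : ℝ) + 1 / 2) * |ξ i| := by
        refine Finset.sum_le_sum fun i hi => ?_
        obtain ⟨h1, h2⟩ := mem_hyperbolicCross_bounds hi
        rw [← sub_smul, ← hξ i, norm_smul, Real.norm_eq_abs, mul_comm]
        gcongr
        refine (norm_legendreDeriv_le hr h1).trans ?_
        have h3 : (i.1 : ℝ) * i.2 ≤ r * n := by exact_mod_cast h2.le
        gcongr ?_ * ?_
        exact Real.rpow_le_rpow (by positivity) h3 (by positivity)
    _ = 4 * ((r : ℝ) * n) ^ (2 * (r : ℝ) + 1 / 2) * ∑ i ∈ hyperbolicCross r n, |ξ i| := by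
        rw [Finset.mul_sum]
    _ ≤ _ := by
        gcongr
        refine (lp_sum_norm_le hp ξ _).trans ?_
        have := card_hyperbolicCross_le hr n
        have h0 : 0 ≤ δ := (lp.norm_nonneg' ξ).trans hδ
        gcongr

/-! ### Asymptotics of the discretization level -/

theorem truncationLevel_pos {s μ δ : ℝ} {p : ℝ≥0∞} (h0 : 0 < δ) (h1 : δ < 1) :
    0 < truncationLevel s μ p δ := by
  have hL : 0 < Real.log (1 / δ) := Real.log_pos (by rw [lt_div_iff₀ h0]; linarith)
  unfold truncationLevel
  positivity

theorem truncationLevel_rpow {s μ δ : ℝ} {p : ℝ≥0∞} (h0 : 0 < δ) (h1 : δ < 1) (a : ℝ) :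
    truncationLevel s μ p δ ^ a = (δ⁻¹ * Real.log (1 / δ) ^ (p⁻¹.toReal - 1 / s)) ^
      (a / (μ - p⁻¹.toReal + 1 / s)) := by
  have hL : 0 < Real.log (1 / δ) := Real.log_pos (by rw [lt_div_iff₀ h0]; linarith)
  unfold truncationLevel
  rw [← Real.rpow_mul (by positivity)]
  congr 1
  ring

theorem log_truncationLevel {s μ δ : ℝ} {p : ℝ≥0∞} (h0 : 0 < δ) (h1 : δ < 1) :
    Real.log (truncationLevel s μ p δ) = 1 / (μ - p⁻¹.toReal + 1 / s) *
      (Real.log (1 / δ) + (p⁻¹.toReal - 1 / s) * Real.log (Real.log (1 / δ))) := by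
  have hL : 0 < Real.log (1 / δ) := Real.log_pos (by rw [lt_div_iff₀ h0]; linarith)
  unfold truncationLevel
  rw [Real.log_rpow (by positivity), Real.log_mul (by positivity) (by positivity),
    Real.log_rpow hL, one_div δ]

theorem truncationLevel_mul_log {s μ δ : ℝ} {p : ℝ≥0∞} (h0 : 0 < δ) (h1 : δ < 1)
    (hγ : 0 < μ - p⁻¹.toReal + 1 / s) :
    truncationLevel s μ p δ * Real.log (1 / δ) =
      (δ⁻¹ * Real.log (1 / δ) ^ μ) ^ (1 / (μ - p⁻¹.toReal + 1 / s)) := by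
  have hL : 0 < Real.log (1 / δ) := Real.log_pos (by rw [lt_div_iff₀ h0]; linarith)
  have h2 : Real.log (1 / δ) ^ μ = Real.log (1 / δ) ^ (p⁻¹.toReal - 1 / s) *
      Real.log (1 / δ) ^ (μ - p⁻¹.toReal + 1 / s) := by
    rw [← Real.rpow_add hL]
    congr 1; ring
  unfold truncationLevel
  rw [h2, ← mul_assoc, Real.mul_rpow (y := Real.log (1 / δ) ^ (μ - p⁻¹.toReal + 1 / s))
    (by positivity) (by positivity), one_div (μ - _ + _),
    Real.rpow_rpow_inv hL.le hγ.ne']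

theorem toReal_inv_mem_Icc {p : ℝ≥0∞} (hp : 1 ≤ p) : p⁻¹.toReal ∈ Set.Icc (0 : ℝ) 1 := by
  refine ⟨ENNReal.toReal_nonneg, ?_⟩
  rw [← ENNReal.toReal_one]
  exact ENNReal.toReal_mono ENNReal.one_ne_top (ENNReal.inv_le_one.2 hp)

theorem one_div_mem_Icc {s : ℝ} (hs : 1 ≤ s) : 1 / s ∈ Set.Icc (0 : ℝ) 1 :=
  ⟨by positivity, by rw [div_le_one (by linarith)]; exact hs⟩

/-- The logarithm of an admissible `n` is at most of the order of `ln (1 / δ)`. -/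
theorem add_log_le_of_le_truncationLevel {s μ : ℝ} {p : ℝ≥0∞} (hs : 1 ≤ s) (hp : 1 ≤ p)
    (hγ : 0 < μ - p⁻¹.toReal + 1 / s) {κ δ₀ a : ℝ} (hκ : 0 < κ) (ha : 0 ≤ a)
    (h0 : 0 < δ₀) (h1 : δ₀ < 1) :
    ∃ C : ℝ, 0 < C ∧ ∀ δ : ℝ, 0 < δ → δ ≤ δ₀ → ∀ n : ℕ, 1 ≤ n →
      n ≤ κ * truncationLevel s μ p δ → a + Real.log n ≤ C * Real.log (1 / δ) := by
  set γ := μ - p⁻¹.toReal + 1 / s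
  have hL0 : 0 < Real.log (1 / δ₀) := Real.log_pos (by rw [lt_div_iff₀ h0]; linarith)
  set L₀ := Real.log (1 / δ₀)
  -- Additive constants are absorbed by `1 ≤ L/L₀`, which needs `δ₀ < 1`; the `2` covers `L` and
  -- `|ln L| ≤ L + |ln L₀|`.
  refine ⟨(a + |Real.log κ| + 1 / γ * |Real.log L₀|) / L₀ + 1 / γ * 2, by positivity,
    fun δ hδ hδ0 n hn hnX => ?_⟩
  have hX := truncationLevel_pos (s := s) (μ := μ) (p := p) hδ (hδ0.trans_lt h1)
  have hLL : L₀ ≤ Real.log (1 / δ) := Real.log_le_log (by positivity) (by gcongr)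
  have hlog := Real.log_le_log (by exact_mod_cast hn) hnX
  rw [Real.log_mul hκ.ne' hX.ne', log_truncationLevel hδ (hδ0.trans_lt h1)] at hlog
  set L := Real.log (1 / δ)
  have hL : 0 < L := hL0.trans_le hLL
  have h2 : |Real.log L| ≤ L + |Real.log L₀| := by
    rw [abs_le]
    have h3 := Real.log_le_log hL0 hLL
    have h4 := Real.log_le_sub_one_of_pos hL
    constructor
    · linarith [neg_abs_le (Real.log L₀)]
    · linarith [abs_nonneg (Real.log L₀)]
  have h5 : |p⁻¹.toReal - 1 / s| ≤ 1 := by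
    have hq := toReal_inv_mem_Icc hp
    have hσ := one_div_mem_Icc hs
    rw [abs_le]
    constructor <;> linarith [hq.1, hq.2, hσ.1, hσ.2]
  have h6 : (p⁻¹.toReal - 1 / s) * Real.log L ≤ L + |Real.log L₀| :=
    calc _ ≤ |(p⁻¹.toReal - 1 / s) * Real.log L| := le_abs_self _
      _ = |p⁻¹.toReal - 1 / s| * |Real.log L| := abs_mul _ _
      _ ≤ 1 * (L + |Real.log L₀|) := by gcongr
      _ = _ := one_mul _
  have h7 : 1 / γ * (L + (p⁻¹.toReal - 1 / s) * Real.log L) ≤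
      1 / γ * (L + (L + |Real.log L₀|)) := by gcongr
  have h8 : a + |Real.log κ| + 1 / γ * |Real.log L₀| ≤
      (a + |Real.log κ| + 1 / γ * |Real.log L₀|) / L₀ * L := by
    generalize hK : a + |Real.log κ| + 1 / γ * |Real.log L₀| = K
    have hK0 : 0 ≤ K := by rw [← hK]; positivity
    rw [div_mul_eq_mul_div, le_div_iff₀ hL0]
    gcongr
  linarith [le_abs_self (Real.log κ)]

/-- The logarithm of an admissible `n` is at least of the order of `ln (1 / δ)`. -/
theorem le_log_of_truncationLevel_le {s μ : ℝ} {p : ℝ≥0∞} (hs : 1 ≤ s) (hp : 1 ≤ p)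
    (hγ : 0 < μ - p⁻¹.toReal + 1 / s) {κ δ : ℝ} (hκ : 0 < κ) (h0 : 0 < δ) (h1 : δ < 1)
    (hL1 : 1 ≤ Real.log (1 / δ))
    (hL : 4 * (μ - p⁻¹.toReal + 1 / s) * |Real.log κ| ≤ Real.log (1 / δ)) {n : ℕ}
    (hn : κ * truncationLevel s μ p δ ≤ n) :
    Real.log (1 / δ) ≤ 4 * (μ - p⁻¹.toReal + 1 / s) * Real.log n := by
  have hX := truncationLevel_pos (s := s) (μ := μ) (p := p) h0 h1
  have hlog := Real.log_le_log (by positivity) hn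
  rw [Real.log_mul hκ.ne' hX.ne', log_truncationLevel h0 h1] at hlog
  set γ := μ - p⁻¹.toReal + 1 / s
  set L := Real.log (1 / δ)
  have h2 : 0 ≤ Real.log L := Real.log_nonneg hL1
  have h3 : Real.log L ≤ L / 2 := by
    have h4 := Real.log_le_sub_one_of_pos (show 0 < L / 2 by linarith)
    rw [Real.log_div (by linarith) two_ne_zero] at h4
    linarith [Real.log_two_lt_d9]
  have h5 : -1 ≤ p⁻¹.toReal - 1 / s := by
    linarith [(toReal_inv_mem_Icc hp).1, (one_div_mem_Icc hs).2]
  have h6 : L / 2 ≤ L + (p⁻¹.toReal - 1 / s) * Real.log L := by nlinarith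
  have h7 : 4 * γ * (1 / γ * (L / 2)) ≤ 4 * γ * (Real.log n + |Real.log κ|) := by
    have : 1 / γ * (L / 2) ≤ 1 / γ * (L + (p⁻¹.toReal - 1 / s) * Real.log L) := by gcongr
    gcongr
    linarith [neg_abs_le (Real.log κ)]
  have h8 : 4 * γ * (1 / γ * (L / 2)) = 2 * L := by field_simp; ring
  linarith

/-! ### Balancing the two errors and counting coefficients -/

theorem exists_norm_mixedDeriv_sub_truncation_le {r : ℕ} (hr : 1 ≤ r) {s : ℝ} (hs : 1 ≤ s)
    {p : ℝ≥0∞} (hp : 1 ≤ p) {μ : ℝ} (hμ : 2 * (r : ℝ) - 1 / s + 3 / 2 < μ) {κ₁ κ₂ : ℝ}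
    (hκ₁ : 0 < κ₁) (hκ₂ : 0 < κ₂) {δ₀ : ℝ} (hδ₀ : 0 < δ₀) (hδ₀' : δ₀ < 1) :
    ∃ C : ℝ, 0 < C ∧ ∀ δ : ℝ, 0 < δ → δ ≤ δ₀ → ∀ n : ℕ,
      κ₁ * truncationLevel s μ p δ ≤ n → n ≤ κ₂ * truncationLevel s μ p δ →
      ∀ f ∈ smoothnessClass s μ, ∀ y : ℕ × ℕ → ℝ, IsPerturbation p δ f y →
        ‖mixedDeriv r f - truncation r n y‖ ≤
          C * ((δ * Real.log (1 / δ) ^ (1 / s - p⁻¹.toReal)) ^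
              ((μ - 2 * (r : ℝ) + 1 / s - 3 / 2) / (μ - p⁻¹.toReal + 1 / s)) *
            Real.log (1 / δ) ^ (2 - 1 / s)) := by
  have hq := toReal_inv_mem_Icc hp
  have hσ := one_div_mem_Icc hs
  have hr1 : (1 : ℝ) ≤ r := by exact_mod_cast hr
  have hγ : 0 < μ - p⁻¹.toReal + 1 / s := by linarith [hq.1, hq.2, hσ.1, hσ.2]
  have hβ : 0 < μ - 2 * (r : ℝ) + 1 / s - 3 / 2 := by linarith
  have hL0 : 0 < Real.log (1 / δ₀) := Real.log_pos (by rw [lt_div_iff₀ hδ₀]; linarith)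
  obtain ⟨C₀, hC₀, hlog⟩ := add_log_le_of_le_truncationLevel hs hp hγ hκ₂
    (a := 2 + 1 / (μ - 2 * (r : ℝ) + 1 / s - 3 / 2)) (by positivity) hδ₀ hδ₀'
  have hXrpow (δ : ℝ) := truncationLevel_rpow (s := s) (μ := μ) (p := p) (δ := δ)
  set β := μ - 2 * (r : ℝ) + 1 / s - 3 / 2 with hβdef
  set γ := μ - p⁻¹.toReal + 1 / s with hγdef
  set q := p⁻¹.toReal
  set L₀ := Real.log (1 / δ₀)
  have hrpos : (0 : ℝ) < r := by linarith
  refine ⟨κ₁ ^ (-β) * (4 * Real.exp 1 * C₀ ^ (2 - 1 / s) +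
    4 * (r : ℝ) ^ (2 * (r : ℝ) + 1 / 2) * (r * C₀) ^ (1 - q) * κ₂ ^ γ / L₀), by positivity,
    fun δ hδ hδ0 n hn1 hn2 f hf y hy => ?_⟩
  have hδ1 := hδ0.trans_lt hδ₀'
  have hX := truncationLevel_pos (s := s) (μ := μ) (p := p) hδ hδ1
  have hLL : L₀ ≤ Real.log (1 / δ) := Real.log_le_log (by positivity) (by gcongr)
  have hnpos : (0 : ℝ) < n := (mul_pos hκ₁ hX).trans_le hn1
  have hn : 1 ≤ n := by exact_mod_cast hnpos
  have hlogn := hlog δ hδ hδ0 n hn hn2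
  have hXγ := hXrpow δ hδ hδ1 γ
  have hXβ := hXrpow δ hδ hδ1 (-β)
  rw [div_self hγ.ne', Real.rpow_one] at hXγ
  have htail := norm_mixedDeriv_sub_truncation_le hr hs hβdef hβ hf hn
  have hnoise := norm_truncation_sub_le hr hp hy n
  set X := truncationLevel s μ p δ
  set L := Real.log (1 / δ)
  have hL : 0 < L := hL0.trans_le hLL
  have hlogn0 : 0 ≤ Real.log n := Real.log_natCast_nonneg n
  have hβ' : 0 < 1 / β := by positivity
  have hXβ' : X ^ (-β) = (δ * L ^ (1 / s - q)) ^ (β / γ) := by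
    have h1 : δ * L ^ (1 / s - q) = (δ⁻¹ * L ^ (q - 1 / s))⁻¹ := by
      rw [mul_inv, inv_inv, ← Real.rpow_neg hL.le]
      congr 2; ring
    rw [hXβ, h1, Real.inv_rpow (by positivity), ← Real.rpow_neg (by positivity), neg_div]
  have hnβ : (n : ℝ) ^ (-β) ≤ κ₁ ^ (-β) * X ^ (-β) := by
    rw [← Real.mul_rpow hκ₁.le hX.le]
    exact Real.rpow_le_rpow_of_nonpos (by positivity) hn1 (by linarith)
  have hnγ : (n : ℝ) ^ γ ≤ κ₂ ^ γ * (δ⁻¹ * L ^ (q - 1 / s)) := by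
    rw [← hXγ, ← Real.mul_rpow hκ₂.le hX.le]
    exact Real.rpow_le_rpow hnpos.le hn2 hγ.le
  have htail' : ‖mixedDeriv r f - truncation r n (fourierLegendre f)‖ ≤
      4 * Real.exp 1 * C₀ ^ (2 - 1 / s) * ((n : ℝ) ^ (-β) * L ^ (2 - 1 / s)) := by
    refine htail.trans ?_
    calc _ ≤ 4 * Real.exp 1 * (n : ℝ) ^ (-β) * (C₀ * L) ^ (2 - 1 / s) := by
          gcongr
          linarith [hσ.2]
      _ = _ := by rw [Real.mul_rpow hC₀.le hL.le]; ring
  have hnoise' : ‖truncation r n (fourierLegendre f) - truncation r n y‖ ≤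
      4 * (r : ℝ) ^ (2 * (r : ℝ) + 1 / 2) * (r * C₀) ^ (1 - q) * κ₂ ^ γ / L₀ *
        ((n : ℝ) ^ (-β) * L ^ (2 - 1 / s)) := by
    refine hnoise.trans ?_
    have e1 : (n : ℝ) ^ (2 * (r : ℝ) + 1 / 2) * (n : ℝ) ^ (1 - q) =
        (n : ℝ) ^ γ * (n : ℝ) ^ (-β) := by
      rw [← Real.rpow_add hnpos, ← Real.rpow_add hnpos]
      congr 1
      rw [hγdef, hβdef]; ring
    have e2 : L ^ (q - 1 / s) * L ^ (1 - q) * L = L ^ (2 - 1 / s) := by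
      rw [← Real.rpow_add hL, ← Real.rpow_add_one hL.ne']
      congr 1; ring
    calc _ ≤ 4 * ((r : ℝ) * n) ^ (2 * (r : ℝ) + 1 / 2) *
          (δ * (r * (n * (C₀ * L))) ^ (1 - q)) := by
          have : 0 ≤ 1 - q := by linarith [hq.2]
          gcongr
          linarith
      _ = 4 * (r : ℝ) ^ (2 * (r : ℝ) + 1 / 2) * (r * C₀) ^ (1 - q) * δ * L ^ (1 - q) *
          ((n : ℝ) ^ γ * (n : ℝ) ^ (-β)) := by
          rw [show (r : ℝ) * (n * (C₀ * L)) = (r * C₀) * (n * L) by ring,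
            Real.mul_rpow hrpos.le hnpos.le, Real.mul_rpow (by positivity) (by positivity),
            Real.mul_rpow hnpos.le hL.le, ← e1]
          ring
      _ ≤ 4 * (r : ℝ) ^ (2 * (r : ℝ) + 1 / 2) * (r * C₀) ^ (1 - q) * δ * L ^ (1 - q) *
          (κ₂ ^ γ * (δ⁻¹ * L ^ (q - 1 / s)) * (n : ℝ) ^ (-β)) := by gcongr
      _ = 4 * (r : ℝ) ^ (2 * (r : ℝ) + 1 / 2) * (r * C₀) ^ (1 - q) * κ₂ ^ γ / L₀ *
          ((n : ℝ) ^ (-β) * (L ^ (q - 1 / s) * L ^ (1 - q) * L₀)) := by field_simp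
      -- The noise carries only `L^{1-1/s}`; the missing factor `L` is gained from `L₀ ≤ L`, hence
      -- the division by `L₀` in the constant.
      _ ≤ 4 * (r : ℝ) ^ (2 * (r : ℝ) + 1 / 2) * (r * C₀) ^ (1 - q) * κ₂ ^ γ / L₀ *
          ((n : ℝ) ^ (-β) * (L ^ (q - 1 / s) * L ^ (1 - q) * L)) := by gcongr
      _ = _ := by rw [e2]
  rw [← hXβ', ← sub_add_sub_cancel _ (truncation r n (fourierLegendre f)) _]
  refine (norm_add_le _ _).trans ((add_le_add htail' hnoise').trans ?_)
  rw [← add_mul]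
  calc _ ≤ (4 * Real.exp 1 * C₀ ^ (2 - 1 / s) +
      4 * (r : ℝ) ^ (2 * (r : ℝ) + 1 / 2) * (r * C₀) ^ (1 - q) * κ₂ ^ γ / L₀) *
        (κ₁ ^ (-β) * X ^ (-β) * L ^ (2 - 1 / s)) := by gcongr
    _ = _ := by ring

theorem exists_card_hyperbolicCross_asymp {r : ℕ} (hr : 1 ≤ r) {s : ℝ} (hs : 1 ≤ s)
    {p : ℝ≥0∞} (hp : 1 ≤ p) {μ : ℝ} (hγ : 0 < μ - p⁻¹.toReal + 1 / s) {κ₁ κ₂ : ℝ}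
    (hκ₁ : 0 < κ₁) (hκ₂ : 0 < κ₂) :
    ∃ c C δ₁ : ℝ, 0 < c ∧ 0 < C ∧ 0 < δ₁ ∧ δ₁ < 1 ∧ ∀ δ : ℝ, 0 < δ → δ ≤ δ₁ → ∀ n : ℕ,
      κ₁ * truncationLevel s μ p δ ≤ n → n ≤ κ₂ * truncationLevel s μ p δ →
        (c * ((n : ℝ) * Real.log n) ≤ ((hyperbolicCross r n).card : ℝ) ∧
          ((hyperbolicCross r n).card : ℝ) ≤ C * ((n : ℝ) * Real.log n)) ∧
        (c * (δ⁻¹ * Real.log (1 / δ) ^ μ) ^ (1 / (μ - p⁻¹.toReal + 1 / s)) ≤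
            (n : ℝ) * Real.log n ∧
          (n : ℝ) * Real.log n ≤
            C * (δ⁻¹ * Real.log (1 / δ) ^ μ) ^ (1 / (μ - p⁻¹.toReal + 1 / s))) := by
  have hr1 : (1 : ℝ) ≤ r := by exact_mod_cast hr
  have hmul (δ : ℝ) := truncationLevel_mul_log (s := s) (μ := μ) (p := p) (δ := δ)
  have hlow (δ : ℝ) := le_log_of_truncationLevel_le (δ := δ) hs hp hγ hκ₁
  set γ := μ - p⁻¹.toReal + 1 / s
  -- The first two summands permit `L ≤ 4γ ln n`; the third then forces `ln n ≥ 2(r+1)`, as the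
  -- lower count requires.
  set L₁ := 1 + 4 * γ * |Real.log κ₁| + 4 * γ * (2 * (r + 1)) with hL₁
  have hL₁pos : 0 < L₁ := by positivity
  have hδ₁ : Real.exp (-L₁) < 1 := by
    rw [← Real.exp_zero]
    exact Real.exp_lt_exp.2 (by linarith)
  obtain ⟨C₀, hC₀, hlog⟩ := add_log_le_of_le_truncationLevel hs hp hγ hκ₂ le_rfl
    (Real.exp_pos (-L₁)) hδ₁
  refine ⟨min (1 / 4) (κ₁ / (4 * γ)), max (2 * r) (κ₂ * C₀), Real.exp (-L₁), by positivity,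
    by positivity, Real.exp_pos _, hδ₁, fun δ hδ hδ0 n hn1 hn2 => ?_⟩
  have hδ1 := hδ0.trans_lt hδ₁
  have hX := truncationLevel_pos (s := s) (μ := μ) (p := p) hδ hδ1
  have hnpos : (0 : ℝ) < n := (mul_pos hκ₁ hX).trans_le hn1
  have hn : 1 ≤ n := by exact_mod_cast hnpos
  have hL : L₁ ≤ Real.log (1 / δ) := by
    have := Real.log_le_log hδ hδ0
    rw [Real.log_exp] at this
    rw [one_div, Real.log_inv]
    linarith
  have ha : 0 ≤ 4 * γ * |Real.log κ₁| := by positivity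
  have hb : 0 ≤ 4 * γ * (2 * ((r : ℝ) + 1)) := by positivity
  have h1 := hlow δ hδ hδ1 (by linarith) (by linarith) hn1
  have h2 := hlog δ hδ hδ0 n hn hn2
  rw [zero_add] at h2
  rw [← hmul δ hδ hδ1 hγ]
  set X := truncationLevel s μ p δ
  set L := Real.log (1 / δ)
  have h3 : 2 * ((r : ℝ) + 1) ≤ Real.log n := by
    have : 4 * γ * (2 * ((r : ℝ) + 1)) ≤ 4 * γ * Real.log n := by linarith
    exact le_of_mul_le_mul_left this (by positivity)
  have hlogn : 0 ≤ Real.log n := by linarith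
  refine ⟨⟨?_, ?_⟩, ?_, ?_⟩
  · calc _ ≤ 1 / 4 * ((n : ℝ) * Real.log n) := by
          gcongr
          exact min_le_left _ _
      _ = (n : ℝ) * Real.log n / 4 := by ring
      _ ≤ _ := le_card_hyperbolicCross hr h3
  · calc _ ≤ r * (n * (1 + Real.log n)) := card_hyperbolicCross_le hr n
      _ ≤ r * (n * (Real.log n + Real.log n)) := by gcongr; linarith
      _ = 2 * r * (n * Real.log n) := by ring
      _ ≤ _ := by
        gcongr
        exact le_max_left _ _
  · calc _ ≤ κ₁ / (4 * γ) * (X * L) := by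
          gcongr
          · exact mul_nonneg hX.le (hL₁pos.le.trans hL)
          · exact min_le_right _ _
      _ ≤ κ₁ / (4 * γ) * (X * (4 * γ * Real.log n)) := by gcongr
      _ = κ₁ * X * Real.log n := by field_simp
      _ ≤ _ := by gcongr
  · calc _ ≤ κ₂ * X * (C₀ * L) := by gcongr
      _ = κ₂ * C₀ * (X * L) := by ring
      _ ≤ _ := by
        gcongr
        · exact mul_nonneg hX.le (hL₁pos.le.trans hL)
        · exact le_max_right _ _

theorem corollary2 (r : ℕ) (hr : 1 ≤ r) (s : ℝ) (hs : 1 ≤ s) (p : ℝ≥0∞) (hp : 1 ≤ p)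
    (μ : ℝ) (hμ : 2 * (r : ℝ) - 1 / s + 3 / 2 < μ)
    (κ₁ κ₂ : ℝ) (hκ₁ : 0 < κ₁) (hκ₂ : 0 < κ₂) :
    -- convergence in `C(Q)` of the series that defines `f^{(r,r)}`
    (∀ f ∈ smoothnessClass s μ, Summable (mixedDerivTerm r f)) ∧
    -- accuracy in the metric of `C(Q)`, uniformly on the class
    (∀ δ₀ : ℝ, δ₀ < 1 → ∃ C : ℝ, 0 < C ∧ ∀ δ : ℝ, 0 < δ → δ ≤ δ₀ → ∀ n : ℕ,
      κ₁ * truncationLevel s μ p δ ≤ n → n ≤ κ₂ * truncationLevel s μ p δ →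
      ∀ f ∈ smoothnessClass s μ, ∀ y : ℕ × ℕ → ℝ, IsPerturbation p δ f y →
        ‖mixedDeriv r f - truncation r n y‖ ≤
          C * ((δ * Real.log (1 / δ) ^ (1 / s - p⁻¹.toReal)) ^
              ((μ - 2 * (r : ℝ) + 1 / s - 3 / 2) / (μ - p⁻¹.toReal + 1 / s)) *
            Real.log (1 / δ) ^ (2 - 1 / s))) ∧
    -- number of perturbed coefficients used
    (∃ c C δ₁ : ℝ, 0 < c ∧ 0 < C ∧ 0 < δ₁ ∧ δ₁ < 1 ∧ ∀ δ : ℝ, 0 < δ → δ ≤ δ₁ → ∀ n : ℕ,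
      κ₁ * truncationLevel s μ p δ ≤ n → n ≤ κ₂ * truncationLevel s μ p δ →
        (c * ((n : ℝ) * Real.log n) ≤ ((hyperbolicCross r n).card : ℝ) ∧
          ((hyperbolicCross r n).card : ℝ) ≤ C * ((n : ℝ) * Real.log n)) ∧
        (c * (δ⁻¹ * Real.log (1 / δ) ^ μ) ^ (1 / (μ - p⁻¹.toReal + 1 / s)) ≤
            (n : ℝ) * Real.log n ∧
          (n : ℝ) * Real.log n ≤
            C * (δ⁻¹ * Real.log (1 / δ) ^ μ) ^ (1 / (μ - p⁻¹.toReal + 1 / s)))) := by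
  have hr1 : (1 : ℝ) ≤ r := by exact_mod_cast hr
  refine ⟨fun f hf => summable_mixedDerivTerm hr hs hμ hf, fun δ₀ hδ₀ => ?_,
    exists_card_hyperbolicCross_asymp hr hs hp ?_ hκ₁ hκ₂⟩
  · rcases lt_or_ge 0 δ₀ with h | h
    · exact exists_norm_mixedDeriv_sub_truncation_le hr hs hp hμ hκ₁ hκ₂ h hδ₀
    · exact ⟨1, one_pos, fun δ h0 h1 => absurd (h0.trans_le h1) (not_lt.2 h)⟩
  · linarith [(toReal_inv_mem_Icc hp).2, (one_div_mem_Icc hs).1, (one_div_mem_Icc hs).2]
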